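/- Let $\ell\ge 1$ and let $\mathbf k\in(\mathbb N\cup\{\infty\})^{\ell}$. Order $\mathbb N^\ell$ (and its extension by $\infty$) componentwise and put $|\mathbf n|=\sum_i n_i$. A vector composition is a finite sequence $\mathbf I=(\mathbf i_1,\dots,\mathbf i_m)$ of nonzero elements of $\mathbb N^\ell$. Let $\mathrm{QSym}^{(\ell)}=\bigoplus_{\mathbf n\in\mathbb N^\ell}\mathrm{QSym}^{(\ell)}_{\mathbf n}$ be the space of quasisymmetric functions of level $\ell$ over $\mathbb Q$: the formal power series of finite degree in commuting variables $x_j^{(i)}$ ($j\ge 1$, $0\le i<\ell$) in which, for every vector composition $\mathbf I$ and all $j_1<\dots<j_m$, the monomials $\mathbf x_{j_1}^{\mathbf i_1}\cdots\mathbf x_{j_m}^{\mathbf i_m}$ and $\mathbf x_{1}^{\mathbf i_1}\cdots\mathbf x_{m}^{\mathbf i_m}$ have the same coefficient, where $\mathbf x_j^{\mathbf n}=\prod_i (x_j^{(i)})^{n_i}$; it is graded by multidegree. It has the basis $M_{\mathbf I}=\sum_{j_1<\dots<j_m}\mathbf x_{j_1}^{\mathbf i_1}\cdots\mathbf x_{j_m}^{\mathbf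 i_m}$ and the coproduct $\Delta(M_{\mathbf I})=\sum_{\mathbf I=\mathbf J\mathbf K}M_{\mathbf J}\otimes M_{\mathbf K}$ (sum over all deconcatenations), with counit the projection onto multidegree $\mathbf 0$. Multiply linear functionals on $\mathrm{QSym}^{(\ell)}$ by convolution. For a functional $\varphi$ let $\varphi_{\mathbf n}$ be its restriction to $\mathrm{QSym}^{(\ell)}_{\mathbf n}$ (extended by zero to the other components), an element of degree $\mathbf n$ of the graded dual algebra $(\mathrm{QSym}^{(\ell)})^*=\bigoplus_{\mathbf n}(\mathrm{QSym}^{(\ell)}_{\mathbf n})^*$, and let $\overline\varphi$ be the functional with $\overline\varphi(h)=(-1)^{|\mathbf n|}\varphi(h)$ for $h\in\mathrm{QSym}^{(\ell)}_{\mathbf n}$. Let $\zeta_{\mathcal Q}$ be the universal character, which evaluates at $x_1^{(i)}=1$ for all $i$ and $x_j^{(i)}=0$ for $j\ne1$; it is convolution invertible. The $\mathbf k$-odd ideal $\mathcal{IO}^{\mathbf k}$ is the two-sided ideal of the graded dual generated by all $(\overline{\zeta_{\mathcal Q}})_{\mathbf n}-(\zeta_{\mathcal Q}^{-1})_{\mathbf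 n}$ with $\mathbf n\in\mathbb N^\ell$, $\mathbf n\le\mathbf k$. Let $\chi=\overline{\zeta_{\mathcal Q}}\,\zeta_{\mathcal Q}$ be the Euler character. **Theorem.** As two-sided ideals of the graded dual, $$\mathcal{IO}^{\mathbf k}=\langle \chi_{\mathbf n}\mid \mathbf 0<\mathbf n\le\mathbf k\rangle=\langle \chi_{\mathbf n}\mid \mathbf 0<\mathbf n\le\mathbf k,\ |\mathbf n|\text{ even}\rangle .$$ -/

import Mathlib

open scoped TensorProduct

noncomputable section

namespace LevelQSym

/-! ### Vector compositions and monomials -/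

/-- The possible columns of a vector composition: `l`-partite numbers of nonzero weight. -/
abbrev Col (l : ℕ) : Type := {c : Fin l → ℕ // c ≠ 0}

/-- Vector compositions: finite sequences of nonzero columns. -/
abbrev VComp (l : ℕ) : Type := List (Col l)

/-- The `l`-partite number `Σ I` obtained by adding up the columns of `I`. -/
def VComp.total {l : ℕ} (I : VComp l) : Fin l → ℕ := (I.map Subtype.val).sum

/-- The weight of an `l`-partite number. -/
def weight {l : ℕ} (n : Fin l → ℕ) : ℕ := ∑ i, n i

/-- The variables: `(j, i)` stands for the `j`-th variable of color `i`; positions start at `0`. -/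
abbrev Var (l : ℕ) : Type := ℕ × Fin l

/-- The exponent of the monomial `x_{j₁}^{i₁} ⋯ x_{jₘ}^{iₘ}`, where `I = (i₁, …, iₘ)`. -/
def expo {l : ℕ} (I : VComp l) (j : Fin I.length → ℕ) : Var l →₀ ℕ :=
  ∑ r, ∑ i, Finsupp.single (j r, i) ((I.get r).1 i)

/-- The exponent of the monomial `x_1^{i₁} ⋯ x_m^{iₘ}` on the first `m` positions. -/
def stdExpo {l : ℕ} (I : VComp l) : Var l →₀ ℕ := expo I (fun r => (r : ℕ))

/-- The multidegree of a monomial. -/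
def mdeg {l : ℕ} (d : Var l →₀ ℕ) : Fin l → ℕ :=
  d.sum fun v e => Pi.single v.2 e

/-! ### Quasisymmetric functions of level `l` -/

/-- A power series of finite degree. -/
def FiniteDegree {l : ℕ} (f : MvPowerSeries (Var l) ℚ) : Prop :=
  ∃ D : ℕ, ∀ d, MvPowerSeries.coeff d f ≠ 0 → d.degree ≤ D

/-- The rational vector space of quasisymmetric functions of level `l`. -/
def QSym (l : ℕ) : Submodule ℚ (MvPowerSeries (Var l) ℚ) where
  carrier := {f | FiniteDegree f ∧
    ∀ (I : VComp l) (j : Fin I.length → ℕ), StrictMono j →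
      MvPowerSeries.coeff (expo I j) f = MvPowerSeries.coeff (stdExpo I) f}
  zero_mem' := ⟨⟨0, by simp⟩, by simp⟩
  add_mem' := by
    rintro f g ⟨⟨D, hD⟩, hf⟩ ⟨⟨E, hE⟩, hg⟩
    refine ⟨⟨max D E, fun d hd => ?_⟩, fun I j hj => by simp [hf I j hj, hg I j hj]⟩
    by_cases h : MvPowerSeries.coeff d f = 0
    · have : MvPowerSeries.coeff d g ≠ 0 := fun h' => hd (by simp [h, h'])
      exact le_max_of_le_right (hE d this)
    · exact le_max_of_le_left (hD d h)
  smul_mem' := by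
    rintro c f ⟨⟨D, hD⟩, hf⟩
    refine ⟨⟨D, fun d hd => hD d fun h => hd (by simp [h])⟩, fun I j hj => by simp [hf I j hj]⟩

/-! ### Facts about monomials -/

theorem expo_apply {l : ℕ} (I : VComp l) (j : Fin I.length → ℕ) (a : ℕ) (i : Fin l) :
    expo I j (a, i) = ∑ r, if j r = a then (I.get r).1 i else 0 := by
  classical
  simp only [expo, Finsupp.finsetSum_apply, Finsupp.single_apply, Prod.mk.injEq]
  refine Finset.sum_congr rfl fun r _ => ?_
  by_cases h : j r = a <;> simp [h]

theorem expo_at {l : ℕ} (I : VComp l) {j : Fin I.length → ℕ} (hj : Function.Injective j)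
    (r : Fin I.length) (i : Fin l) : expo I j (j r, i) = (I.get r).1 i := by
  simp [expo_apply, hj.eq_iff]

theorem expo_off {l : ℕ} (I : VComp l) {j : Fin I.length → ℕ} {a : ℕ} (ha : a ∉ Set.range j)
    (i : Fin l) : expo I j (a, i) = 0 := by
  rw [expo_apply]
  refine Finset.sum_eq_zero fun r _ => if_neg fun h => ha ⟨r, h⟩

theorem mem_range_iff {l : ℕ} (I : VComp l) {j : Fin I.length → ℕ} (hj : Function.Injective j)
    (a : ℕ) : a ∈ Set.range j ↔ ∃ i, expo I j (a, i) ≠ 0 := by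
  constructor
  · rintro ⟨r, rfl⟩
    by_contra! h
    refine (I.get r).2 (funext fun i => ?_)
    rw [← expo_at I hj, h i]; rfl
  · rintro ⟨i, hi⟩
    by_contra h
    exact hi (expo_off I h i)

theorem expo_inj {l : ℕ} {I J : VComp l} {j : Fin I.length → ℕ} {k : Fin J.length → ℕ}
    (hj : StrictMono j) (hk : StrictMono k) (h : expo I j = expo J k) : I = J := by
  have hr : Set.range j = Set.range k := by
    ext a
    rw [mem_range_iff I hj.injective, mem_range_iff J hk.injective, h]
  have hl : I.length = J.length := by
    have h1 := Set.ncard_range_of_injective hj.injective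
    have h2 := Set.ncard_range_of_injective hk.injective
    rw [hr, h2] at h1
    simpa using h1.symm
  have hjk : j = fun r => k (Fin.cast hl r) := by
    refine (StrictMono.range_inj hj (hk.comp (Fin.cast_strictMono hl))).1 ?_
    rw [hr]
    exact ((finCongr hl).surjective.range_comp k).symm
  refine List.ext_get hl fun n h1 h2 => Subtype.ext (funext fun i => ?_)
  have e1 := expo_at I hj.injective ⟨n, h1⟩ i
  have e2 := expo_at J hk.injective ⟨n, h2⟩ i
  rw [← e1, ← e2, h, hjk]
  rfl

theorem exists_expo {l : ℕ} (d : Var l →₀ ℕ) :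
    ∃ (I : VComp l) (j : Fin I.length → ℕ), StrictMono j ∧ expo I j = d := by
  classical
  set R : Finset ℕ := d.support.image Prod.fst with hR
  let e := R.orderEmbOfFin rfl
  have hne (r : Fin R.card) : (fun i => d (e r, i)) ≠ 0 := by
    have := R.orderEmbOfFin_mem rfl r
    obtain ⟨⟨a, i⟩, hv, ha⟩ := Finset.mem_image.1 this
    intro h0
    have := congrFun h0 i
    simp only [Finsupp.mem_support_iff] at hv
    apply hv
    rw [show a = e r from ha]
    exact this
  let I : VComp l := List.ofFn fun r => (⟨fun i => d (e r, i), hne r⟩ : Col l)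
  have hl : I.length = R.card := List.length_ofFn
  have hj : StrictMono (fun r : Fin I.length => e (Fin.cast hl r)) :=
    e.strictMono.comp (Fin.cast_strictMono hl)
  refine ⟨I, fun r => e (Fin.cast hl r), hj, ?_⟩
  ext ⟨a, i⟩
  by_cases ha : a ∈ Set.range (fun r : Fin I.length => e (Fin.cast hl r))
  · obtain ⟨r, rfl⟩ := ha
    rw [expo_at I hj.injective]
    simp [I]
    rfl
  · rw [expo_off I ha]
    by_contra h
    have : a ∈ R := Finset.mem_image.2 ⟨(a, i), Finsupp.mem_support_iff.2 (Ne.symm h), rfl⟩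
    have h2 : a ∈ Set.range e := by
      rw [Finset.range_orderEmbOfFin]; exact this
    obtain ⟨r, rfl⟩ := h2
    exact ha ⟨Fin.cast hl.symm r, rfl⟩

theorem std_strictMono {m : ℕ} : StrictMono (fun r : Fin m => (r : ℕ)) := fun _ _ h => h

theorem stdExpo_injective {l : ℕ} : Function.Injective (stdExpo (l := l)) := fun _ _ h =>
  expo_inj std_strictMono std_strictMono h

theorem mdeg_add {l : ℕ} (d e : Var l →₀ ℕ) : mdeg (d + e) = mdeg d + mdeg e := by
  classical
  exact Finsupp.sum_add_index' (by simp) (by intro v a b; exact Pi.single_add _ _ _)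

theorem mdeg_expo {l : ℕ} (I : VComp l) (j : Fin I.length → ℕ) :
    mdeg (expo I j) = I.total := by
  classical
  let φ : (Var l →₀ ℕ) →+ (Fin l → ℕ) := ⟨⟨mdeg, by simp [mdeg]⟩, mdeg_add⟩
  have h : mdeg (expo I j) = φ (expo I j) := rfl
  have hs (v : Var l) (e : ℕ) : φ (Finsupp.single v e) = Pi.single v.2 e := by
    change mdeg _ = _
    simp [mdeg]
  rw [h, expo, map_sum]
  simp only [map_sum, hs]
  rw [VComp.total, ← Fin.sum_univ_fun_getElem]
  refine Finset.sum_congr rfl fun r _ => ?_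
  exact Finset.univ_sum_single _

theorem degree_eq {l : ℕ} (d : Var l →₀ ℕ) : d.degree = weight (mdeg d) := by
  classical
  simp only [weight, mdeg, Finsupp.sum, Finset.sum_apply, Finsupp.degree]
  rw [Finset.sum_comm]
  exact Finset.sum_congr rfl fun v _ => by simp

theorem length_le_weight {l : ℕ} (I : VComp l) : I.length ≤ weight I.total := by
  induction I with
  | nil => simp
  | cons a I ih =>
    have h1 : weight (VComp.total (a :: I)) = weight a.1 + weight (VComp.total I) := by
      simp [weight, VComp.total, Finset.sum_add_distrib]
    have h2 : 1 ≤ weight a.1 := by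
      rw [Nat.one_le_iff_ne_zero]
      intro h
      refine a.2 (funext fun i => ?_)
      exact (Finset.sum_eq_zero_iff.1 h) i (Finset.mem_univ i)
    rw [h1, List.length_cons]
    omega

theorem finite_box {l : ℕ} (D N : ℕ) :
    {d : Var l →₀ ℕ | d.degree ≤ D ∧ ∀ v, d v ≠ 0 → v.1 < N}.Finite := by
  classical
  refine (Set.finite_Iic (∑ v ∈ (Finset.range N ×ˢ (Finset.univ : Finset (Fin l))),
    Finsupp.single v D)).subset ?_
  rintro d ⟨h1, h2⟩
  intro v
  by_cases hv : d v = 0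
  · rw [hv]; exact Nat.zero_le _
  · have hmem : v ∈ Finset.range N ×ˢ (Finset.univ : Finset (Fin l)) := by
      simp [h2 v hv]
    rw [Finsupp.finsetSum_apply]
    refine le_trans ?_ (Finset.single_le_sum (f := fun w => (Finsupp.single w D) v)
      (fun _ _ => Nat.zero_le _) hmem)
    simp only [Finsupp.single_eq_same]
    exact (Finsupp.le_degree v d).trans h1

theorem finite_comps {l : ℕ} (D : ℕ) : {I : VComp l | (stdExpo I).degree ≤ D}.Finite := by
  refine Set.Finite.of_injOn (f := stdExpo) ?_ stdExpo_injective.injOn (finite_box D D)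
  intro I hI
  refine ⟨hI, fun v hv => ?_⟩
  obtain ⟨a, i⟩ := v
  have : a ∈ Set.range (fun r : Fin I.length => (r : ℕ)) :=
    (mem_range_iff I std_strictMono.injective a).2 ⟨i, hv⟩
  obtain ⟨r, rfl⟩ := this
  have h1 := length_le_weight I
  have h2 : (stdExpo I).degree = weight I.total := by rw [degree_eq, stdExpo, mdeg_expo]
  have h3 : (stdExpo I).degree ≤ D := hI
  have := r.2
  simp only
  omega

/-! ### The monomial basis -/

open Classical in
/-- The monomial quasisymmetric function `M_I`, the sum of all monomials
`x_{j₁}^{i₁} ⋯ x_{jₘ}^{iₘ}` with `j₁ < ⋯ < jₘ`; distinct `j` give distinct monomials. -/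
def monomialSeries {l : ℕ} (I : VComp l) : MvPowerSeries (Var l) ℚ :=
  fun d => if ∃ j : Fin I.length → ℕ, StrictMono j ∧ expo I j = d then 1 else 0

theorem coeff_monomialSeries {l : ℕ} (I J : VComp l) {j : Fin J.length → ℕ} (hj : StrictMono j) :
    MvPowerSeries.coeff (expo J j) (monomialSeries I) = if I = J then 1 else 0 := by
  classical
  rw [MvPowerSeries.coeff_apply, monomialSeries]
  by_cases h : I = J
  · subst h
    rw [if_pos ⟨j, hj, rfl⟩, if_pos rfl]
  · rw [if_neg h, if_neg]
    rintro ⟨k, hk, hkj⟩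
    exact h (expo_inj hk hj hkj)

theorem monomialSeries_mem {l : ℕ} (I : VComp l) : monomialSeries I ∈ QSym l := by
  classical
  refine ⟨⟨weight I.total, fun d hd => ?_⟩, fun J j hj => ?_⟩
  · rw [MvPowerSeries.coeff_apply, monomialSeries] at hd
    split_ifs at hd with h
    · obtain ⟨j, -, rfl⟩ := h
      rw [degree_eq, mdeg_expo]
    · exact absurd rfl hd
  · rw [coeff_monomialSeries I J hj, stdExpo, coeff_monomialSeries I J std_strictMono]

/-- `M_I` as an element of the space of quasisymmetric functions. -/
def M {l : ℕ} (I : VComp l) : QSym l := ⟨monomialSeries I, monomialSeries_mem I⟩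

/-- The coefficients of a quasisymmetric function with respect to the `M_I`. -/
def coords (l : ℕ) : QSym l →ₗ[ℚ] (VComp l →₀ ℚ) where
  toFun f := Finsupp.ofSupportFinite (fun I => MvPowerSeries.coeff (stdExpo I) f.1) <| by
    obtain ⟨D, hD⟩ := f.2.1
    exact (finite_comps D).subset fun I hI => hD _ hI
  map_add' f g := by ext I; simp [Finsupp.ofSupportFinite_coe]
  map_smul' c f := by ext I; simp [Finsupp.ofSupportFinite_coe]

theorem coords_apply {l : ℕ} (f : QSym l) (I : VComp l) :
    coords l f I = MvPowerSeries.coeff (stdExpo I) f.1 := rfl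

theorem coords_M {l : ℕ} (I : VComp l) : coords l (M I) = Finsupp.single I 1 := by
  classical
  ext J
  rw [coords_apply, stdExpo, M, coeff_monomialSeries I J std_strictMono, Finsupp.single_apply]

theorem coords_bijective (l : ℕ) : Function.Bijective (coords l) := by
  constructor
  · intro f g h
    refine Subtype.ext (MvPowerSeries.ext fun d => ?_)
    obtain ⟨I, j, hj, rfl⟩ := exists_expo d
    rw [f.2.2 I j hj, g.2.2 I j hj, ← coords_apply, ← coords_apply, h]
  · intro c
    refine ⟨c.sum fun I a => a • M I, ?_⟩
    rw [map_finsuppSum]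
    simp only [map_smul, coords_M, Finsupp.smul_single, smul_eq_mul, mul_one]
    exact Finsupp.sum_single c

/-- The `M_I` form a basis of the space of quasisymmetric functions. -/
def basisM (l : ℕ) : Module.Basis (VComp l) ℚ (QSym l) :=
  ⟨LinearEquiv.ofBijective (coords l) (coords_bijective l)⟩

theorem basisM_apply {l : ℕ} (I : VComp l) : basisM l I = M I := by
  apply (coords_bijective l).1
  rw [coords_M]
  exact (basisM l).repr_self I

/-! ### The coalgebra structure -/

/-- The coproduct: deconcatenation on the monomial basis. -/
def comulM (l : ℕ) : QSym l →ₗ[ℚ] QSym l ⊗[ℚ] QSym l :=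
  (basisM l).constr ℚ fun I =>
    ∑ p ∈ Finset.range (I.length + 1), M (I.take p) ⊗ₜ[ℚ] M (I.drop p)

theorem comulM_M {l : ℕ} (I : VComp l) :
    comulM l (M I) = ∑ p ∈ Finset.range (I.length + 1), M (I.take p) ⊗ₜ[ℚ] M (I.drop p) := by
  rw [← basisM_apply, comulM, Module.Basis.constr_basis]

/-- The counit: the projection onto the component of multidegree `0`, that is, the constant
coefficient. -/
def counitM (l : ℕ) : QSym l →ₗ[ℚ] ℚ := (MvPowerSeries.coeff 0).comp (QSym l).subtype

theorem counitM_M {l : ℕ} (I : VComp l) : counitM l (M I) = if I = [] then 1 else 0 := by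
  have h : (0 : Var l →₀ ℕ) = expo ([] : VComp l) (fun r => (r : ℕ)) := by simp [expo]
  change MvPowerSeries.coeff 0 (monomialSeries I) = _
  rw [h, coeff_monomialSeries I [] std_strictMono]

instance instCoalgebra (l : ℕ) : Coalgebra ℚ (QSym l) where
  comul := comulM l
  counit := counitM l
  coassoc := by
    refine (basisM l).ext fun I => ?_
    simp only [basisM_apply, LinearMap.comp_apply, comulM_M, map_sum, LinearMap.rTensor_tmul,
      LinearMap.lTensor_tmul, TensorProduct.sum_tmul, TensorProduct.tmul_sum,
      LinearEquiv.coe_coe, TensorProduct.assoc_tmul]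
    rw [Finset.sum_sigma', Finset.sum_sigma']
    refine Finset.sum_nbij' (fun x => ⟨x.2, x.1 - x.2⟩) (fun x => ⟨x.1 + x.2, x.1⟩) ?_ ?_ ?_ ?_ ?_
    · rintro ⟨i, j⟩ h
      simp at h ⊢
      omega
    · rintro ⟨i, j⟩ h
      simp at h ⊢
      omega
    · rintro ⟨i, j⟩ h
      simp at h ⊢
      omega
    · rintro ⟨i, j⟩ h
      simp
    · rintro ⟨i, j⟩ h
      simp at h
      have h1 : j ≤ i := by omega
      simp [List.take_take, List.drop_take, h1]
  rTensor_counit_comp_comul := by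
    refine (basisM l).ext fun I => ?_
    simp only [basisM_apply, LinearMap.comp_apply, comulM_M, map_sum, LinearMap.rTensor_tmul,
      counitM_M]
    rw [Finset.sum_eq_single 0]
    · simp
    · intro p hp h0
      have : I.take p ≠ [] := by
        intro h
        simp at h hp
        rcases h with h | h
        · exact h0 h
        · subst h; simp at hp; exact h0 hp
      simp [this]
    · simp
  lTensor_counit_comp_comul := by
    refine (basisM l).ext fun I => ?_
    simp only [basisM_apply, LinearMap.comp_apply, comulM_M, map_sum, LinearMap.lTensor_tmul,
      counitM_M]
    rw [Finset.sum_eq_single I.length]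
    · simp
    · intro p hp h0
      have : I.drop p ≠ [] := by
        intro h
        simp at h hp
        omega
      simp [this]
    · simp

/-! ### Linear functionals under convolution -/

/-- Linear functionals on the quasisymmetric functions, a ring under convolution. -/
abbrev Functional (l : ℕ) : Type := WithConv (QSym l →ₗ[ℚ] ℚ)

theorem conv_M {l : ℕ} (φ ψ : Functional l) (I : VComp l) :
    (φ * ψ) (M I) = ∑ p ∈ Finset.range (I.length + 1), φ (M (I.take p)) * ψ (M (I.drop p)) := by
  rw [LinearMap.convMul_apply]
  change LinearMap.mul' ℚ ℚ (TensorProduct.map φ.ofConv ψ.ofConv (comulM l (M I))) = _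
  simp [comulM_M]

theorem one_M {l : ℕ} (I : VComp l) : (1 : Functional l) (M I) = if I = [] then 1 else 0 := by
  rw [LinearMap.convOne_apply]
  exact counitM_M I

theorem functional_ext {l : ℕ} {φ ψ : Functional l} (h : ∀ I : VComp l, φ (M I) = ψ (M I)) :
    φ = ψ :=
  WithConv.ext ((basisM l).ext fun I => by rw [basisM_apply]; exact h I)

/-- The homogeneous component of multidegree `n` of a quasisymmetric function. -/
def proj {l : ℕ} (n : Fin l → ℕ) : QSym l →ₗ[ℚ] QSym l where
  toFun f := ⟨fun d => if mdeg d = n then MvPowerSeries.coeff d f.1 else 0, by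
    obtain ⟨D, hD⟩ := f.2.1
    refine ⟨⟨D, fun d hd => hD d fun h => hd ?_⟩, fun I j hj => ?_⟩
    · change (if mdeg d = n then MvPowerSeries.coeff d f.1 else 0) = 0
      rw [h, ite_self]
    · change (if mdeg (expo I j) = n then MvPowerSeries.coeff (expo I j) f.1 else 0) =
        if mdeg (stdExpo I) = n then MvPowerSeries.coeff (stdExpo I) f.1 else 0
      rw [stdExpo, mdeg_expo, mdeg_expo, f.2.2 I j hj, stdExpo]⟩
  map_add' f g := by
    refine Subtype.ext (funext fun d => ?_)
    change (if mdeg d = n then MvPowerSeries.coeff d (f.1 + g.1) else 0) =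
      (if mdeg d = n then MvPowerSeries.coeff d f.1 else 0) +
        (if mdeg d = n then MvPowerSeries.coeff d g.1 else 0)
    split_ifs <;> simp
  map_smul' c f := by
    refine Subtype.ext (funext fun d => ?_)
    change (if mdeg d = n then MvPowerSeries.coeff d (c • f.1) else 0) =
      c * (if mdeg d = n then MvPowerSeries.coeff d f.1 else 0)
    split_ifs <;> simp

theorem proj_M {l : ℕ} (n : Fin l → ℕ) (I : VComp l) :
    proj n (M I) = if I.total = n then M I else 0 := by
  refine Subtype.ext (MvPowerSeries.ext fun d => ?_)
  obtain ⟨J, j, hj, rfl⟩ := exists_expo d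
  have h1 : MvPowerSeries.coeff (expo J j) (proj n (M I)).1 =
      if mdeg (expo J j) = n then MvPowerSeries.coeff (expo J j) (monomialSeries I) else 0 := rfl
  rw [h1, mdeg_expo, coeff_monomialSeries I J hj]
  by_cases hIJ : I = J
  · subst hIJ
    by_cases hn : I.total = n
    · simp [hn, M, coeff_monomialSeries I I hj]
    · simp [hn]
  · by_cases hn : I.total = n
    · simp [hn, M, coeff_monomialSeries I J hj, hIJ]
    · simp [hn, hIJ]

/-- The component `φ_n` of a functional: its restriction to multidegree `n`, extended by zero to
the other homogeneous components. -/
def component {l : ℕ} (n : Fin l → ℕ) (φ : Functional l) : Functional l :=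
  WithConv.toConv (φ.ofConv.comp (proj n))

theorem component_M {l : ℕ} (n : Fin l → ℕ) (φ : Functional l) (I : VComp l) :
    component n φ (M I) = if I.total = n then φ (M I) else 0 := by
  change φ.ofConv (proj n (M I)) = _
  rw [proj_M]
  split_ifs <;> simp

/-- The map `f ↦ (-1)^{|n|} f` for `f` homogeneous of multidegree `n`. -/
def signTwist (l : ℕ) : QSym l →ₗ[ℚ] QSym l where
  toFun f := ⟨fun d => (-1) ^ weight (mdeg d) * MvPowerSeries.coeff d f.1, by
    obtain ⟨D, hD⟩ := f.2.1
    refine ⟨⟨D, fun d hd => hD d fun h => hd ?_⟩, fun I j hj => ?_⟩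
    · change _ * MvPowerSeries.coeff d f.1 = 0
      rw [h, mul_zero]
    · change (-1) ^ weight (mdeg (expo I j)) * MvPowerSeries.coeff (expo I j) f.1 =
        (-1) ^ weight (mdeg (stdExpo I)) * MvPowerSeries.coeff (stdExpo I) f.1
      rw [stdExpo, mdeg_expo, mdeg_expo, f.2.2 I j hj, stdExpo]⟩
  map_add' f g := by
    refine Subtype.ext (funext fun d => ?_)
    change _ * MvPowerSeries.coeff d (f.1 + g.1) = _ * _ + _ * _
    rw [map_add, mul_add]
  map_smul' c f := by
    refine Subtype.ext (funext fun d => ?_)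
    change _ * MvPowerSeries.coeff d (c • f.1) = c * (_ * _)
    rw [map_smul, smul_eq_mul]
    ring

/-- The involution `φ ↦ φ̄`, with `φ̄(f) = (-1)^{|n|} φ(f)` for `f` of multidegree `n`. -/
def bar {l : ℕ} (φ : Functional l) : Functional l :=
  WithConv.toConv (φ.ofConv.comp (signTwist l))

/-! ### The graded dual -/

theorem total_take_add_drop {l : ℕ} (I : VComp l) (p : ℕ) :
    VComp.total (I.take p) + VComp.total (I.drop p) = I.total := by
  unfold VComp.total
  rw [← List.sum_append, ← List.map_append, List.take_append_drop]

theorem component_ne_zero {l : ℕ} {φ : Functional l} {I : VComp l} (h : φ (M I) ≠ 0) :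
    component I.total φ ≠ 0 := by
  intro h0
  have := component_M I.total φ I
  rw [h0, if_pos rfl] at this
  exact h this.symm

theorem exists_of_component_ne_zero {l : ℕ} {φ : Functional l} {n : Fin l → ℕ}
    (h : component n φ ≠ 0) : ∃ I : VComp l, I.total = n ∧ φ (M I) ≠ 0 := by
  by_contra! hc
  refine h (functional_ext fun I => ?_)
  rw [component_M]
  split_ifs with hI
  · exact hc I hI
  · rfl

/-- The graded dual as a subalgebra of the convolution algebra: the functionals which vanish on
all but finitely many of the homogeneous components. -/
def gradedDual (l : ℕ) : Subalgebra ℚ (Functional l) where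
  carrier := {φ | {n | component n φ ≠ 0}.Finite}
  mul_mem' := by
    intro φ ψ hφ hψ
    refine (Set.Finite.image2 (· + ·) hφ hψ).subset fun n hn => ?_
    obtain ⟨I, rfl, hI⟩ := exists_of_component_ne_zero hn
    rw [conv_M] at hI
    obtain ⟨p, -, hp⟩ := Finset.exists_ne_zero_of_sum_ne_zero hI
    exact ⟨_, component_ne_zero (left_ne_zero_of_mul hp), _,
      component_ne_zero (right_ne_zero_of_mul hp), total_take_add_drop I p⟩
  add_mem' := by
    intro φ ψ hφ hψ
    refine (Set.Finite.union hφ hψ).subset fun n hn => ?_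
    by_contra h
    simp only [Set.mem_union, Set.mem_ofPred_eq, not_or, not_not] at h
    refine hn (functional_ext fun I => ?_)
    have h1 := congrArg (fun θ : Functional l => θ (M I)) h.1
    have h2 := congrArg (fun θ : Functional l => θ (M I)) h.2
    simp only [component_M] at h1 h2
    rw [component_M]
    split_ifs with hI
    · rw [if_pos hI] at h1 h2
      change φ (M I) + ψ (M I) = 0
      rw [h1, h2]
      simp
    · rfl
  algebraMap_mem' := by
    intro r
    refine (Set.finite_singleton (0 : Fin l → ℕ)).subset fun n hn => ?_
    obtain ⟨I, rfl, hI⟩ := exists_of_component_ne_zero hn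
    rw [Algebra.algebraMap_eq_smul_one] at hI
    have h1 : (1 : Functional l) (M I) ≠ 0 := by
      intro h
      apply hI
      change r * (1 : Functional l) (M I) = 0
      rw [h, mul_zero]
    rw [one_M] at h1
    have h2 : I = [] := by
      by_contra h
      exact h1 (if_neg h)
    subst h2
    rfl

theorem component_mem {l : ℕ} (n : Fin l → ℕ) (φ : Functional l) :
    component n φ ∈ gradedDual l := by
  refine (Set.finite_singleton n).subset fun m hm => ?_
  obtain ⟨I, rfl, hI⟩ := exists_of_component_ne_zero hm
  rw [component_M] at hI
  by_contra h
  exact hI (if_neg h)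

/-- The graded dual of the quasisymmetric functions of level `l`, with the convolution product. -/
def GradedDual (l : ℕ) : Type := gradedDual l

instance instRingGradedDual (l : ℕ) : Ring (GradedDual l) := (gradedDual l).toRing

instance instAlgebraGradedDual (l : ℕ) : Algebra ℚ (GradedDual l) := (gradedDual l).algebra

/-- The component `φ_n` as an element of degree `n` of the graded dual. -/
def comp {l : ℕ} (n : Fin l → ℕ) (φ : Functional l) : GradedDual l :=
  (⟨component n φ, component_mem n φ⟩ : gradedDual l)

/-! ### The universal character and its inverse -/

/-- The monomial with exponent `d` evaluated at `x_1^{(i)} = 1` for all colors `i` and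
`x_j^{(i)} = 0` for `j ≠ 1`; position `0` is the first one. -/
def evalMonomial {l : ℕ} (d : Var l →₀ ℕ) : ℚ :=
  d.prod fun v e => (if v.1 = 0 then (1 : ℚ) else 0) ^ e

theorem evalMonomial_eq {l : ℕ} (d : Var l →₀ ℕ) [Decidable (∀ v, d v ≠ 0 → v.1 = 0)] :
    evalMonomial d = if ∀ v, d v ≠ 0 → v.1 = 0 then 1 else 0 := by
  unfold evalMonomial Finsupp.prod
  split_ifs with h
  · refine Finset.prod_eq_one fun v hv => ?_
    simp only
    rw [if_pos (h v (Finsupp.mem_support_iff.1 hv)), one_pow]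
  · push Not at h
    obtain ⟨v, hv, h0⟩ := h
    refine Finset.prod_eq_zero (Finsupp.mem_support_iff.2 hv) ?_
    simp only
    rw [if_neg h0, zero_pow hv]

theorem finite_eval {l : ℕ} (f : QSym l) :
    (Function.support fun d => MvPowerSeries.coeff d f.1 * evalMonomial d).Finite := by
  classical
  obtain ⟨D, hD⟩ := f.2.1
  refine (finite_box D 1).subset fun d hd => ⟨hD d (left_ne_zero_of_mul hd), ?_⟩
  have h := right_ne_zero_of_mul hd
  rw [evalMonomial_eq] at h
  intro v hv
  by_contra h1
  exact h (if_neg fun h2 => h1 (by rw [h2 v hv]; exact Nat.zero_lt_one))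

/-- The universal character: evaluation at `x_1^{(i)} = 1` for all colors `i` and
`x_j^{(i)} = 0` for `j ≠ 1`; the sum has only finitely many nonzero terms. -/
def zetaQ (l : ℕ) : Functional l := WithConv.toConv
  { toFun := fun f => ∑ᶠ d, MvPowerSeries.coeff d f.1 * evalMonomial d
    map_add' := fun f g => by
      rw [← finsum_add_distrib (finite_eval f) (finite_eval g)]
      exact finsum_congr fun d => by rw [Submodule.coe_add, map_add, add_mul]
    map_smul' := fun c f => by
      rw [RingHom.id_apply, smul_finsum' c (finite_eval f)]
      exact finsum_congr fun d => by
        rw [Submodule.coe_smul, map_smul, smul_eq_mul, smul_eq_mul, mul_assoc] }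

theorem zetaQ_M {l : ℕ} (I : VComp l) : zetaQ l (M I) = if I.length ≤ 1 then 1 else 0 := by
  classical
  have hdef : zetaQ l (M I) =
      ∑ᶠ d, MvPowerSeries.coeff d (monomialSeries I) * evalMonomial d := rfl
  rw [hdef]
  have key (d : Var l →₀ ℕ)
      (h : MvPowerSeries.coeff d (monomialSeries I) * evalMonomial d ≠ 0) :
      I.length ≤ 1 ∧ d = stdExpo I := by
    have h1 := left_ne_zero_of_mul h
    have h2 := right_ne_zero_of_mul h
    rw [MvPowerSeries.coeff_apply, monomialSeries] at h1
    split_ifs at h1 with h3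
    swap
    · exact absurd rfl h1
    obtain ⟨j, hj, rfl⟩ := h3
    rw [evalMonomial_eq] at h2
    split_ifs at h2 with h4
    swap
    · exact absurd rfl h2
    have h5 (r : Fin I.length) : j r = 0 := by
      obtain ⟨i, hi⟩ := (mem_range_iff I hj.injective (j r)).1 ⟨r, rfl⟩
      exact h4 _ hi
    have h6 : I.length ≤ 1 := by
      by_contra! h7
      have := hj (show (⟨0, by omega⟩ : Fin I.length) < ⟨1, h7⟩ from Nat.zero_lt_one)
      rw [h5, h5] at this
      exact lt_irrefl _ this
    refine ⟨h6, ?_⟩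
    rw [stdExpo]
    congr 1
    funext r
    rw [h5 r]
    have := r.2
    omega
  split_ifs with hI
  · rw [finsum_eq_single _ (stdExpo I) fun d hd => by
      by_contra h
      exact hd (key d h).2]
    rw [stdExpo, coeff_monomialSeries I I std_strictMono, if_pos rfl, one_mul, evalMonomial_eq,
      if_pos]
    intro v hv
    obtain ⟨a, i⟩ := v
    obtain ⟨r, rfl⟩ := (mem_range_iff I std_strictMono.injective a).2 ⟨i, hv⟩
    have := r.2
    simp only
    omega
  · rw [finsum_eq_zero_of_forall_eq_zero]
    intro d
    by_contra h
    exact hI (key d h).1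

/-- The functional `M_I ↦ (-1)^{len I}`, which turns out to be the inverse of `zetaQ`. -/
def lengthSign (l : ℕ) : Functional l :=
  WithConv.toConv ((basisM l).constr ℚ fun I => (-1) ^ I.length)

theorem lengthSign_M {l : ℕ} (I : VComp l) : lengthSign l (M I) = (-1) ^ I.length := by
  change (basisM l).constr ℚ _ (M I) = _
  rw [← basisM_apply, Module.Basis.constr_basis]

theorem zetaQ_mul_lengthSign (l : ℕ) : zetaQ l * lengthSign l = 1 := by
  refine functional_ext fun I => ?_
  rw [conv_M, one_M]
  simp only [zetaQ_M, lengthSign_M]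
  cases I with
  | nil => simp
  | cons a I =>
    rw [List.length_cons, Finset.sum_range_succ', Finset.sum_range_succ',
      Finset.sum_eq_zero fun p hp => ?_]
    · simp [pow_succ]
    · have h1 := Finset.mem_range.1 hp
      rw [if_neg, zero_mul]
      rw [List.length_take, List.length_cons]
      omega

theorem lengthSign_mul_zetaQ (l : ℕ) : lengthSign l * zetaQ l = 1 := by
  refine functional_ext fun I => ?_
  rw [conv_M, one_M]
  simp only [zetaQ_M, lengthSign_M]
  cases I with
  | nil => simp
  | cons a I =>
    rw [List.length_cons, Finset.sum_range_succ, Finset.sum_range_succ,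
      Finset.sum_eq_zero fun p hp => ?_]
    · simp [pow_succ]
    · have h1 := Finset.mem_range.1 hp
      rw [if_neg, mul_zero]
      rw [List.length_drop, List.length_cons]
      omega

/-- The universal character as an invertible element for convolution. -/
def zetaQUnit (l : ℕ) : (Functional l)ˣ :=
  ⟨zetaQ l, lengthSign l, zetaQ_mul_lengthSign l, lengthSign_mul_zetaQ l⟩

/-! ### The odd ideal and the Euler character -/

/-- For an extended `l`-partite number `k`, the relation `n ≤ k`. -/
def LeExt {l : ℕ} (n : Fin l → ℕ) (k : Fin l → ℕ∞) : Prop := ∀ i, (n i : ℕ∞) ≤ k i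

/-- The two-sided ideal of the graded dual generated by all `φ_n - ψ_n` with `n ≤ k`. -/
def kIdeal {l : ℕ} (k : Fin l → ℕ∞) (φ ψ : Functional l) : TwoSidedIdeal (GradedDual l) :=
  TwoSidedIdeal.span {x | ∃ n : Fin l → ℕ, LeExt n k ∧ x = comp n φ - comp n ψ}

/-- The `k`-odd ideal of the quasisymmetric functions with their universal character `ζ`, that is,
the ideal belonging to the pair `ζ̄`, `ζ⁻¹`. -/
def kOddIdeal {l : ℕ} (k : Fin l → ℕ∞) : TwoSidedIdeal (GradedDual l) :=
  kIdeal k (bar (zetaQ l)) ((zetaQUnit l)⁻¹ : (Functional l)ˣ)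

/-- The Euler character `χ = ζ̄ ζ`. -/
def eulerChar (l : ℕ) : Functional l := bar (zetaQ l) * zetaQ l

end LevelQSym

end

/-! Write `ζ` for the universal character, `D = ζ̄ - ζ⁻¹` for the difference whose components
generate the odd ideal, and `E = χ - 1`. Then `D ζ = E` and `E ζ⁻¹ = D`. The degree `n` component of
a product is `∑ φ_m ψ_{n-m}` over `m ≤ n`, and the multidegrees bounded by `k` form a down-set.
Hence an ideal containing all `D_m` with `m ≤ k` contains all `E_n` with `n ≤ k`, and conversely. As
`E_0 = 0` and `E_n = χ_n` for `n ≠ 0`, this is the first equality.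

For the second, `ζ E = Ē ζ`, since `χ̄ = ζ ζ̄`. In a degree `n` of odd weight, the extreme terms of
the two sides are `E_n` and `-E_n`, because `ζ_0 = 1`; all other terms involve only `E_m` with `m <
n`. So `2 E_n` lies in the ideal generated by the lower components, and induction on `n` removes the
odd degrees. The lemmas that carry this are `comp_mul`, `oddDiff_mul_zetaQ`, `eulerChar_sub_one_mul`
and `zetaQ_mul_eulerChar_sub_one`. -/

namespace LevelQSym

/-! ### Homogeneous components and convolution -/

/-- The inclusion of the graded dual into the convolution algebra. -/
noncomputable def toFunctional (l : ℕ) : GradedDual l →+* Functional l := (gradedDual l).val.toRingHom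

theorem toFunctional_injective (l : ℕ) : Function.Injective (toFunctional l) :=
  Subtype.val_injective

theorem toFunctional_comp {l : ℕ} (n : Fin l → ℕ) (φ : Functional l) :
    toFunctional l (comp n φ) = component n φ := rfl

theorem sum_functional_apply {l : ℕ} {ι : Type*} (s : Finset ι) (f : ι → Functional l)
    (x : QSym l) : (∑ i ∈ s, f i) x = ∑ i ∈ s, f i x := by
  classical
  induction s using Finset.induction_on with
  | empty => rfl
  | insert a s ha ih =>
    rw [Finset.sum_insert ha, Finset.sum_insert ha, ← ih]
    rfl

theorem comp_sub {l : ℕ} (n : Fin l → ℕ) (φ ψ : Functional l) :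
    comp n (φ - ψ) = comp n φ - comp n ψ := rfl

/-- The components of a convolution product. -/
theorem comp_mul {l : ℕ} (n : Fin l → ℕ) (φ ψ : Functional l) :
    comp n (φ * ψ) = ∑ m ∈ Finset.Iic n, comp m φ * comp (n - m) ψ := by
  refine toFunctional_injective l (functional_ext fun I => ?_)
  simp only [map_sum, map_mul, toFunctional_comp]
  rw [sum_functional_apply]
  simp only [component_M, conv_M]
  -- With the cut `p` outside, at most one `m` contributes to each cut, namely the total of the
  -- first `p` columns.
  rw [Finset.sum_comm]
  split_ifs with hI
  · refine Finset.sum_congr rfl fun p _ => ?_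
    have ht := total_take_add_drop I p
    rw [hI] at ht
    rw [Finset.sum_eq_single (VComp.total (I.take p))]
    · rw [if_pos rfl, if_pos (by rw [← ht, add_tsub_cancel_left])]
    · intro m _ hm
      rw [if_neg (Ne.symm hm), zero_mul]
    · intro hm
      exact absurd (Finset.mem_Iic.2 (by rw [← ht]; exact le_self_add)) hm
  -- A nonzero term would force the totals of the two pieces to be `m` and `n - m`, hence the total
  -- of `I` to be `n`.
  · refine (Finset.sum_eq_zero fun p _ => Finset.sum_eq_zero fun m hm => ?_).symm
    have ht := total_take_add_drop I p
    by_cases h1 : VComp.total (I.take p) = m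
    · by_cases h2 : VComp.total (I.drop p) = n - m
      · refine absurd ?_ hI
        rw [← ht, h1, h2, add_tsub_cancel_of_le (Finset.mem_Iic.1 hm)]
      · rw [if_neg h2, mul_zero]
    · rw [if_neg h1, zero_mul]

theorem eq_nil_of_total_eq_zero {l : ℕ} {I : VComp l} (h : I.total = 0) : I = [] := by
  have := length_le_weight I
  rw [h] at this
  simpa [weight] using this

/-- Multidegree zero is spanned by `M []`, so this single value determines the component. -/
theorem comp_zero_eq_zero {l : ℕ} {φ : Functional l} (h : φ (M []) = 0) : comp 0 φ = 0 := by
  refine toFunctional_injective l (functional_ext fun I => ?_)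
  rw [toFunctional_comp, component_M, map_zero]
  split_ifs with hI
  · rw [eq_nil_of_total_eq_zero hI, h]
    rfl
  · rfl

theorem comp_one {l : ℕ} {n : Fin l → ℕ} (hn : n ≠ 0) : comp n (1 : Functional l) = 0 := by
  refine toFunctional_injective l (functional_ext fun I => ?_)
  rw [toFunctional_comp, component_M, map_zero, one_M]
  split_ifs with h1 h2
  · subst h2
    exact absurd h1.symm hn
  · rfl
  · rfl

theorem comp_zero_eq_one {l : ℕ} {φ : Functional l} (h : φ (M []) = 1) : comp 0 φ = 1 := by
  refine toFunctional_injective l (functional_ext fun I => ?_)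
  rw [toFunctional_comp, component_M, map_one, one_M]
  by_cases hI : I = []
  · subst hI
    rw [if_pos rfl, h]
    exact if_pos rfl
  · rw [if_neg hI, if_neg fun h0 => hI (eq_nil_of_total_eq_zero h0)]

/-! ### The sign involution -/

theorem signTwist_M {l : ℕ} (I : VComp l) :
    signTwist l (M I) = (-1 : ℚ) ^ weight I.total • M I := by
  refine Subtype.ext (MvPowerSeries.ext fun d => ?_)
  obtain ⟨J, j, hj, rfl⟩ := exists_expo d
  change (-1) ^ weight (mdeg (expo J j)) * MvPowerSeries.coeff (expo J j) (monomialSeries I) =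
    (-1) ^ weight I.total * MvPowerSeries.coeff (expo J j) (monomialSeries I)
  rw [mdeg_expo, coeff_monomialSeries I J hj]
  split_ifs with h
  · rw [h]
  · rw [mul_zero, mul_zero]

theorem bar_M {l : ℕ} (φ : Functional l) (I : VComp l) :
    bar φ (M I) = (-1) ^ weight I.total * φ (M I) := by
  change φ.ofConv (signTwist l (M I)) = _
  rw [signTwist_M, map_smul]
  rfl

theorem weight_add {l : ℕ} (m n : Fin l → ℕ) : weight (m + n) = weight m + weight n :=
  Finset.sum_add_distrib

/-- Deconcatenation splits the total additively, so the sign of `I` is the product of the signs of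
its two pieces. -/
theorem bar_mul {l : ℕ} (φ ψ : Functional l) : bar (φ * ψ) = bar φ * bar ψ := by
  refine functional_ext fun I => ?_
  rw [bar_M, conv_M, conv_M, Finset.mul_sum]
  refine Finset.sum_congr rfl fun p _ => ?_
  rw [bar_M, bar_M, ← total_take_add_drop I p, weight_add, pow_add]
  ring

theorem bar_bar {l : ℕ} (φ : Functional l) : bar (bar φ) = φ := by
  refine functional_ext fun I => ?_
  rw [bar_M, bar_M, ← mul_assoc, ← mul_pow]
  simp

theorem bar_one (l : ℕ) : bar (1 : Functional l) = 1 := by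
  refine functional_ext fun I => ?_
  rw [bar_M, one_M]
  split_ifs with h
  · subst h
    simp [VComp.total, weight]
  · rw [mul_zero]

theorem bar_sub {l : ℕ} (φ ψ : Functional l) : bar (φ - ψ) = bar φ - bar ψ := rfl

theorem comp_bar_of_odd {l : ℕ} {n : Fin l → ℕ} (hn : Odd (weight n)) (φ : Functional l) :
    comp n (bar φ) = -comp n φ := by
  refine toFunctional_injective l (functional_ext fun I => ?_)
  rw [map_neg, toFunctional_comp, toFunctional_comp]
  change _ = -(component n φ (M I))
  rw [component_M, component_M, bar_M]
  split_ifs with h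
  · rw [h, hn.neg_one_pow, neg_one_mul]
  · rw [neg_zero]

/-- The sign is a factor in the ring itself, so that a two-sided ideal absorbs it. -/
theorem comp_bar {l : ℕ} (n : Fin l → ℕ) (φ : Functional l) :
    comp n (bar φ) = (-1) ^ weight n * comp n φ := by
  rcases Nat.even_or_odd (weight n) with hn | hn
  · rw [hn.neg_one_pow, one_mul]
    refine toFunctional_injective l (functional_ext fun I => ?_)
    rw [toFunctional_comp, toFunctional_comp, component_M, component_M, bar_M]
    split_ifs with h
    · rw [h, hn.neg_one_pow, one_mul]
    · rfl
  · rw [comp_bar_of_odd hn, hn.neg_one_pow, neg_one_mul]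

/-! ### Ideals containing components, and identities for the Euler character -/

theorem LeExt.mono {l : ℕ} {m n : Fin l → ℕ} {k : Fin l → ℕ∞} (h : LeExt n k) (hmn : m ≤ n) :
    LeExt m k := fun i => (Nat.cast_le.2 (hmn i)).trans (h i)

/-- A two-sided ideal that contains the components of `φ` of multidegree at most `n` contains the
component of multidegree `n` of `φ * ψ`. -/
theorem comp_mul_mem {l : ℕ} {J : TwoSidedIdeal (GradedDual l)} {n : Fin l → ℕ}
    {φ : Functional l} (h : ∀ m ≤ n, comp m φ ∈ J) (ψ : Functional l) :
    comp n (φ * ψ) ∈ J := by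
  rw [comp_mul]
  exact sum_mem fun m hm => J.mul_mem_right _ _ (h m (Finset.mem_Iic.1 hm))

theorem zetaQ_nil (l : ℕ) : zetaQ l (M []) = 1 := by simp [zetaQ_M]

theorem eulerChar_nil (l : ℕ) : eulerChar l (M []) = 1 := by
  rw [eulerChar, conv_M]
  simp only [bar_M]
  simp [zetaQ_M, VComp.total, weight]

/-- `comp_mul_mem` needs every degree below `n`, zero included. The component `χ_0 = 1` would
generate the whole ring; subtracting the unit removes it. -/
theorem comp_zero_eulerChar_sub_one (l : ℕ) : comp 0 (eulerChar l - 1) = 0 := by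
  refine comp_zero_eq_zero ?_
  change eulerChar l (M []) - (1 : Functional l) (M []) = 0
  rw [eulerChar_nil, one_M, if_pos rfl, sub_self]

theorem comp_eulerChar_sub_one {l : ℕ} {n : Fin l → ℕ} (hn : n ≠ 0) :
    comp n (eulerChar l - 1) = comp n (eulerChar l) := by
  rw [comp_sub, comp_one hn, sub_zero]

theorem oddDiff_mul_zetaQ (l : ℕ) :
    (bar (zetaQ l) - ((zetaQUnit l)⁻¹ : (Functional l)ˣ)) * zetaQ l = eulerChar l - 1 := by
  rw [sub_mul, eulerChar]
  congr 1
  exact (zetaQUnit l).inv_mul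

theorem eulerChar_sub_one_mul (l : ℕ) :
    (eulerChar l - 1) * ((zetaQUnit l)⁻¹ : (Functional l)ˣ) =
      bar (zetaQ l) - ((zetaQUnit l)⁻¹ : (Functional l)ˣ) := by
  rw [← oddDiff_mul_zetaQ, mul_assoc, show zetaQ l = (zetaQUnit l : Functional l) from rfl,
    Units.mul_inv, mul_one]

/-- Both sides equal `ζ ζ̄ ζ - ζ`. Comparing them in an odd degree gives `E_n` opposite signs. -/
theorem zetaQ_mul_eulerChar_sub_one (l : ℕ) :
    zetaQ l * (eulerChar l - 1) = bar (eulerChar l - 1) * zetaQ l := by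
  rw [bar_sub, bar_one, eulerChar, bar_mul, bar_bar]
  rw [mul_sub, sub_mul, mul_one, one_mul, mul_assoc]

/-! ### Generation by all positive degrees -/

/-- The odd ideal is generated by the components of positive degree of the Euler character. -/
theorem kOddIdeal_eq_span {l : ℕ} (k : Fin l → ℕ∞) :
    kOddIdeal k = TwoSidedIdeal.span {x | ∃ n : Fin l → ℕ, 0 < n ∧ LeExt n k ∧
      x = comp n (eulerChar l)} := by
  refine le_antisymm (TwoSidedIdeal.span_le.2 ?_) (TwoSidedIdeal.span_le.2 ?_)
  · rintro _ ⟨n, hn, rfl⟩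
    rw [← comp_sub, ← eulerChar_sub_one_mul]
    refine comp_mul_mem (fun m hm => ?_) _
    rcases eq_or_ne m 0 with rfl | h0
    · rw [comp_zero_eulerChar_sub_one]
      exact TwoSidedIdeal.zero_mem _
    · rw [comp_eulerChar_sub_one h0]
      exact TwoSidedIdeal.subset_span ⟨m, pos_iff_ne_zero.2 h0, hn.mono hm, rfl⟩
  · rintro _ ⟨n, h0, hn, rfl⟩
    rw [← comp_eulerChar_sub_one h0.ne', ← oddDiff_mul_zetaQ]
    refine comp_mul_mem (fun m hm => ?_) _
    -- Degree zero is among the generators of the odd ideal, so here `m = 0` needs no separate case.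
    exact TwoSidedIdeal.subset_span ⟨m, hn.mono hm, comp_sub m _ _⟩

/-! ### Elimination of the odd degrees -/

theorem mem_of_add_self_mem {l : ℕ} {J : TwoSidedIdeal (GradedDual l)} {x : GradedDual l}
    (h : x + x ∈ J) : x ∈ J := by
  have h2 := J.mul_mem_left (algebraMap ℚ (GradedDual l) (1 / 2)) _ h
  rwa [← Algebra.smul_def, ← two_smul ℚ x, smul_smul, one_div, inv_mul_cancel₀ two_ne_zero,
    one_smul] at h2

/-- A two-sided ideal that contains the components of even degree at most `n` of the Euler
character, shifted by one, contains all components up to `n`. -/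
theorem comp_eulerChar_sub_one_mem {l : ℕ} {J : TwoSidedIdeal (GradedDual l)} (n : Fin l → ℕ)
    (h : ∀ m ≤ n, Even (weight m) → comp m (eulerChar l - 1) ∈ J) :
    comp n (eulerChar l - 1) ∈ J := by
  induction n using WellFoundedLT.induction with
  | ind n ih =>
  rcases Nat.even_or_odd (weight n) with hn | hn
  · exact h n le_rfl hn
  have hlt : ∀ m < n, comp m (eulerChar l - 1) ∈ J := fun m hm =>
    ih m hm fun p hp => h p (hp.trans hm.le)
  have hz : comp 0 (zetaQ l) = 1 := comp_zero_eq_one (zetaQ_nil l)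
  -- The degree `n` part of `ζ E` without its term `m = 0`, which is `E_n`; for `m ≠ 0` the index `n
  -- - m` is strictly below `n`.
  have hA : ∑ m ∈ (Finset.Iic n).erase 0,
      comp m (zetaQ l) * comp (n - m) (eulerChar l - 1) ∈ J := by
    refine sum_mem fun m hm => J.mul_mem_left _ _ (hlt _ (lt_of_le_of_ne tsub_le_self fun he => ?_))
    obtain ⟨hm0, hmn⟩ := Finset.mem_erase.1 hm
    have hs := tsub_add_cancel_of_le (Finset.mem_Iic.1 hmn)
    rw [he] at hs
    exact hm0 (left_eq_add.1 hs.symm)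
  -- The degree `n` part of `Ē ζ` without its term `m = n`, which is `-E_n` as the weight of `n` is
  -- odd.
  have hB : ∑ m ∈ (Finset.Iic n).erase n,
      comp m (bar (eulerChar l - 1)) * comp (n - m) (zetaQ l) ∈ J := by
    refine sum_mem fun m hm => J.mul_mem_right _ _ ?_
    obtain ⟨hmn, hm⟩ := Finset.mem_erase.1 hm
    rw [comp_bar]
    exact J.mul_mem_left _ _ (hlt m (lt_of_le_of_ne (Finset.mem_Iic.1 hm) hmn))
  -- With `A` and `B` the sums in `hA` and `hB`, this becomes `E_n + A - (-E_n + B) = 0`, so `E_n +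
  -- E_n = B - A`.
  have hl := congrArg (comp n) (zetaQ_mul_eulerChar_sub_one l)
  rw [comp_mul, comp_mul, ← Finset.add_sum_erase _ _ (Finset.mem_Iic.2 (zero_le (a := n))),
    ← Finset.add_sum_erase _ _ (Finset.mem_Iic.2 (le_refl n)), tsub_zero, tsub_self, hz, one_mul,
    mul_one, comp_bar_of_odd hn, ← sub_eq_zero] at hl
  have hx := J.sub_mem hB hA
  refine mem_of_add_self_mem ?_
  convert hx using 1
  rw [← sub_eq_zero, ← hl]
  abel

/-- The odd ideal is generated by the components of positive even degree of the Euler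
character. -/
theorem kOddIdeal_eq_span_even {l : ℕ} (k : Fin l → ℕ∞) :
    kOddIdeal k = TwoSidedIdeal.span {x | ∃ n : Fin l → ℕ, 0 < n ∧ LeExt n k ∧
      Even (weight n) ∧ x = comp n (eulerChar l)} := by
  rw [kOddIdeal_eq_span]
  refine le_antisymm (TwoSidedIdeal.span_le.2 ?_) (TwoSidedIdeal.span_mono ?_)
  · rintro _ ⟨n, h0, hn, rfl⟩
    rw [← comp_eulerChar_sub_one h0.ne']
    refine comp_eulerChar_sub_one_mem n fun m hm he => ?_
    -- Zero has even weight but is not a generating degree; its component of `χ - 1` vanishes.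
    rcases eq_or_ne m 0 with rfl | hm0
    · rw [comp_zero_eulerChar_sub_one]
      exact TwoSidedIdeal.zero_mem _
    · rw [comp_eulerChar_sub_one hm0]
      exact TwoSidedIdeal.subset_span ⟨m, pos_iff_ne_zero.2 hm0, hn.mono hm, he, rfl⟩
  · rintro _ ⟨n, h0, hn, -, rfl⟩
    exact ⟨n, h0, hn, rfl⟩

end LevelQSym

theorem theoremT (l : ℕ) (hl : 0 < l) (k : Fin l → ℕ∞) :
    LevelQSym.kOddIdeal k =
        TwoSidedIdeal.span {x | ∃ n : Fin l → ℕ, 0 < n ∧ LevelQSym.LeExt n k ∧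
          x = LevelQSym.comp n (LevelQSym.eulerChar l)} ∧
      LevelQSym.kOddIdeal k =
        TwoSidedIdeal.span {x | ∃ n : Fin l → ℕ, 0 < n ∧ LevelQSym.LeExt n k ∧
          Even (LevelQSym.weight n) ∧ x = LevelQSym.comp n (LevelQSym.eulerChar l)} := by
  exact ⟨LevelQSym.kOddIdeal_eq_span k, LevelQSym.kOddIdeal_eq_span_even k⟩
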